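/- Let $n\ge 0$, let $\bar x=(x_1,\dots,x_n)$ and $\bar y=(y_1,\dots,y_n)$ be tuples of variables, and let $\mathbb{C}[\bar x]^E$ be the ring of exponential polynomials over $(\mathbb{C},\exp)$ (the free exponential ring over $\mathbb C$ in $\bar x$, obtained as the union of the chain $R_0=\mathbb{C}[\bar x]$, $R_{k+1}=R_k[t^{A_k}]$, where $A_0$ is the ideal $(\bar x)$ of $R_0$, $A_{k+1}$ is the $R_k$-span of the $t^a$ with $0\ne a\in A_k$, and the exponential map $E$ is $\exp$ on $\mathbb C$ and satisfies $E(r+b)=E(r)\,t^b$ for $b\in A_k$ and $r\in R_{k-1}$, with $R_{-1}=\mathbb{C}$). An E-ideal of an exponential ring is an ideal $L$ such that $E(\alpha)-1\in L$ for all $\alpha\in L$; it is a prime E-ideal if it is also a prime ideal. For an ideal $I\subseteq\mathbb{C}[\bar x,\bar y]$ let $J$ be the E-ideal of $\mathbb{C}[\bar x]^E$ generated by all $p(\bar x,E(\bar x))=p(x_1,\dots,x_n,E(x_1),\dots,E(x_n))$ with $p\in I$. For an integer $m\ge1$ let $I_m$ be the ideal generated by $I$ in $\mathbb{C}[\bar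 x,\bar y^{1/m}]$, the polynomial ring in the variables $x_i$ and $y_i^{1/m}$, which contains $\mathbb{C}[\bar x,\bar y]$. For $\bar q\in\mathbb{Q}^n$ put $\bar y^{\bar q}=y_1^{q_1}\cdots y_n^{q_n}\in\mathbb{C}[\bar x,\bar y^{\mathbb{Q}}]\supseteq \mathbb{C}[\bar x,\bar y]$. Suppose that 1. $I$ is a prime ideal; 2. $I$ contains no nonzero element of the form $a+q_1x_1+\dots+q_nx_n$ with $\bar q\in\mathbb{Q}^n$ and $a\in\mathbb{C}$; 3. $I$ contains no nonzero element of the form $\bar y^{\bar q}-a$ with $\bar q\in\mathbb{Q}^n$ and $a\in\mathbb{C}$; 4. for every integer $m\ge1$ the ideal $I_m$ of $\mathbb{C}[\bar x,\bar y^{1/m}]$ is prime. Then $J$ is a prime E-ideal of $\mathbb{C}[\bar x]^E$. -/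

import Mathlib

/-! ### Exponential rings and E-ideals -/

/-- An exponential ring: a commutative ring `R` with a homomorphism `E` from `(R, +)` to the
multiplicative group of units of `R`. A function with `E 0 = 1` and `E (a + b) = E a * E b`
automatically takes values in the units, because `E a * E (-a) = 1`. -/
class ERing (R : Type*) [CommRing R] where
  /-- The exponential map. -/
  E : R → R
  E_zero : E 0 = 1
  E_add : ∀ a b : R, E (a + b) = E a * E b

/-- The complex numbers with the usual exponential function. -/
noncomputable instance Complex.instERing : ERing ℂ where
  E := Complex.exp
  E_zero := Complex.exp_zero
  E_add := Complex.exp_add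

/-- An E-ideal: an ideal `I` such that `E a - 1 ∈ I` for every `a ∈ I`. -/
def IsEIdeal {R : Type*} [CommRing R] [ERing R] (I : Ideal R) : Prop :=
  ∀ a ∈ I, ERing.E a - 1 ∈ I

/-- A prime E-ideal: an E-ideal that is prime as an ideal. -/
def IsPrimeEIdeal {R : Type*} [CommRing R] [ERing R] (I : Ideal R) : Prop :=
  IsEIdeal I ∧ I.IsPrime

/-- The E-ideal generated by a set `s`: the smallest E-ideal that contains `s`. -/
def eIdealSpan {R : Type*} [CommRing R] [ERing R] (s : Set R) : Ideal R :=
  sInf {I : Ideal R | IsEIdeal I ∧ s ⊆ (I : Set R)}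

/-! ### Partial exponential rings and their free completion -/

/-- A split partial E-ring, that is, a partial E-ring with a chosen complement of the domain: a `ℚ`-algebra `D`, a `ℚ`-linear subspace `V` of `D` that
contains `ℚ`, and a homomorphism `E` from `(V, +)` to the units of `D` (see `ERing` for why `E`
may be written with values in `D`), together with a chosen linear complement `A` of `V` in `D`. -/
structure SplitPartialERing where
  /-- The underlying ring `D`. -/
  carrier : Type*
  [commRing : CommRing carrier]
  [algebraRat : Algebra ℚ carrier]
  /-- The domain of the exponential map. -/
  V : Submodule ℚ carrier
  one_mem : (1 : carrier) ∈ V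
  /-- The chosen complement of the domain. -/
  A : Submodule ℚ carrier
  isCompl : IsCompl V A
  /-- The exponential map. -/
  E : V → carrier
  E_zero : E 0 = 1
  E_add : ∀ v w : V, E (v + w) = E v * E w

namespace SplitPartialERing

attribute [instance] SplitPartialERing.commRing SplitPartialERing.algebraRat

/-- The extended exponential map from `D` to the group ring `D[t^A]`: an element `v + b` with
`v ∈ V` and `b ∈ A` is sent to `E v * t ^ b`. -/
noncomputable def expNext (D : SplitPartialERing) (r : D.carrier) :
    AddMonoidAlgebra D.carrier D.A :=
  AddMonoidAlgebra.single (D.A.projectionOnto D.V D.isCompl.symm r)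
    (D.E (D.V.projectionOnto D.A D.isCompl r))

theorem expNext_zero (D : SplitPartialERing) : D.expNext 0 = 1 := by
  simp [expNext, D.E_zero, AddMonoidAlgebra.one_def]

theorem expNext_add (D : SplitPartialERing) (r s : D.carrier) :
    D.expNext (r + s) = D.expNext r * D.expNext s := by
  simp [expNext, D.E_add, AddMonoidAlgebra.single_mul_single]

/-- The coefficient of `t ^ 0` as a linear map from `D[t^A]` to `D`. -/
noncomputable def coeffZero (D : SplitPartialERing) :
    AddMonoidAlgebra D.carrier D.A →ₗ[ℚ] D.carrier where
  toFun f := f.coeff 0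
  map_add' f g := by simp
  map_smul' c f := by simp

/-- The inclusion of `D` in `D[t^A]` as a linear map. -/
noncomputable def inclLinear (D : SplitPartialERing) :
    D.carrier →ₗ[ℚ] AddMonoidAlgebra D.carrier D.A where
  toFun r := AddMonoidAlgebra.single 0 r
  map_add' r s := AddMonoidAlgebra.single_add _ _ _
  map_smul' c r := by simp

theorem coeffZero_inclLinear (D : SplitPartialERing) (r : D.carrier) :
    D.coeffZero (D.inclLinear r) = r := by
  change (AddMonoidAlgebra.single (0 : D.A) r).coeff 0 = r
  simp

theorem isCompl_next (D : SplitPartialERing) :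
    IsCompl (LinearMap.range D.inclLinear) (LinearMap.ker D.coeffZero) := by
  rw [isCompl_iff, Submodule.disjoint_def, codisjoint_iff, eq_top_iff]
  constructor
  · rintro _ ⟨r, rfl⟩ h
    rw [LinearMap.mem_ker, coeffZero_inclLinear] at h
    simp [h]
  · intro f _
    refine Submodule.mem_sup.2 ⟨D.inclLinear (D.coeffZero f), ⟨_, rfl⟩,
      f - D.inclLinear (D.coeffZero f), ?_, by abel⟩
    rw [LinearMap.mem_ker, map_sub, coeffZero_inclLinear, sub_self]

/-- One step of the construction: the ring `D[t^A]`, whose exponential map is defined on the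
subring `D` (by `expNext`), and where the chosen complement of `D` is the span over `D` of the
`t ^ a` with `0 ≠ a ∈ A`. -/
noncomputable def next (D : SplitPartialERing) : SplitPartialERing where
  carrier := AddMonoidAlgebra D.carrier D.A
  V := LinearMap.range D.inclLinear
  one_mem := ⟨1, rfl⟩
  A := LinearMap.ker D.coeffZero
  isCompl := D.isCompl_next
  E v := D.expNext (D.coeffZero v)
  E_zero := by simp [expNext_zero]
  E_add v w := by simp [expNext_add]

/-- The inclusion of `D` in the next ring `D[t^A]`. -/
noncomputable def incl (D : SplitPartialERing) : D.carrier →+* D.next.carrier :=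
  (AddMonoidAlgebra.singleZeroRingHom :
    D.carrier →+* AddMonoidAlgebra D.carrier D.A)

/-- `expNext` as a map into the next ring. -/
noncomputable def exp (D : SplitPartialERing) (r : D.carrier) : D.next.carrier := D.expNext r

theorem exp_incl (D : SplitPartialERing) (r : D.carrier) :
    D.next.exp (D.incl r) = D.next.incl (D.exp r) := by
  have hmem : D.incl r ∈ D.next.V := ⟨r, rfl⟩
  have h1 : D.next.A.projectionOnto D.next.V D.next.isCompl.symm (D.incl r) = 0 :=
    (Submodule.projectionOnto_apply_eq_zero_iff _).2 hmem
  have h2 : D.next.V.projectionOnto D.next.A D.next.isCompl (D.incl r) = ⟨D.incl r, hmem⟩ :=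
    Submodule.projectionOnto_apply_left D.next.isCompl ⟨D.incl r, hmem⟩
  have h3 : D.next.E ⟨D.incl r, hmem⟩ = D.exp r :=
    congrArg D.expNext (D.coeffZero_inclLinear r)
  change D.next.expNext (D.incl r) = AddMonoidAlgebra.single 0 (D.exp r)
  rw [expNext, h1, h2, h3]

/-- The chain of partial E-rings that starts with `D`. -/
noncomputable def tower (D : SplitPartialERing) : ℕ → SplitPartialERing
  | 0 => D
  | k + 1 => (D.tower k).next

/-- The inclusion of a ring of the chain in the next one. -/
noncomputable def towerIncl (D : SplitPartialERing) (k : ℕ) :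
    (D.tower k).carrier →+* (D.tower (k + 1)).carrier :=
  (D.tower k).incl

/-- The exponential map from a ring of the chain to the next one. -/
noncomputable def towerExp (D : SplitPartialERing) (k : ℕ) (x : (D.tower k).carrier) :
    (D.tower (k + 1)).carrier :=
  (D.tower k).exp x

theorem towerExp_zero (D : SplitPartialERing) (k : ℕ) : D.towerExp k 0 = 1 :=
  (D.tower k).expNext_zero

theorem towerExp_add (D : SplitPartialERing) (k : ℕ) (x y : (D.tower k).carrier) :
    D.towerExp k (x + y) = D.towerExp k x * D.towerExp k y :=
  (D.tower k).expNext_add x y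

theorem towerExp_towerIncl (D : SplitPartialERing) (k : ℕ) (x : (D.tower k).carrier) :
    D.towerExp (k + 1) (D.towerIncl k x) = D.towerIncl (k + 1) (D.towerExp k x) :=
  (D.tower k).exp_incl x

/-- The inclusions between the rings of the chain. -/
noncomputable def towerMap (D : SplitPartialERing) (i j : ℕ) (h : i ≤ j) :
    (D.tower i).carrier →+* (D.tower j).carrier :=
  Nat.leRecOn (C := fun k => (D.tower i).carrier →+* (D.tower k).carrier) h
    (fun {k} g => (D.towerIncl k).comp g) (RingHom.id _)

theorem towerMap_self (D : SplitPartialERing) (i : ℕ) (x : (D.tower i).carrier) :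
    D.towerMap i i le_rfl x = x :=
  congrArg (fun g : (D.tower i).carrier →+* (D.tower i).carrier => g x)
    (Nat.leRecOn_self (C := fun k => (D.tower i).carrier →+* (D.tower k).carrier)
      (next := fun {k} g => (D.towerIncl k).comp g) (RingHom.id _))

theorem towerMap_succ (D : SplitPartialERing) (i j : ℕ) (h : i ≤ j) (x : (D.tower i).carrier) :
    D.towerMap i (j + 1) (h.trans j.le_succ) x = D.towerIncl j (D.towerMap i j h x) :=
  congrArg (fun g : (D.tower i).carrier →+* (D.tower (j + 1)).carrier => g x)
    (Nat.leRecOn_succ (C := fun k => (D.tower i).carrier →+* (D.tower k).carrier)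
      (next := fun {k} g => (D.towerIncl k).comp g) h (RingHom.id _))

theorem towerMap_trans (D : SplitPartialERing) (i j k : ℕ) (hij : i ≤ j) (hjk : j ≤ k)
    (x : (D.tower i).carrier) :
    D.towerMap j k hjk (D.towerMap i j hij x) = D.towerMap i k (hij.trans hjk) x := by
  induction k, hjk using Nat.le_induction with
  | base => exact D.towerMap_self j _
  | succ k hjk ih => rw [towerMap_succ D j k hjk, ih, towerMap_succ D i k (hij.trans hjk)]

instance directedSystem_tower (D : SplitPartialERing) :
    DirectedSystem (fun k => (D.tower k).carrier) (fun i j h => D.towerMap i j h) where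
  map_self i x := D.towerMap_self i x
  map_map _ _ _ hij hjk x := D.towerMap_trans _ _ _ hij hjk x

/-- The free completion of a partial E-ring: the union of the chain `tower`. -/
def Completion (D : SplitPartialERing) : Type _ :=
  DirectLimit (fun k => (D.tower k).carrier) D.towerMap

noncomputable instance (D : SplitPartialERing) : CommRing D.Completion :=
  inferInstanceAs (CommRing (DirectLimit (fun k => (D.tower k).carrier) D.towerMap))

/-- The inclusion of the `k`-th ring of the chain in the completion. -/
noncomputable def ofLevel (D : SplitPartialERing) (k : ℕ) :
    (D.tower k).carrier →+* D.Completion where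
  toFun x := (⟦⟨k, x⟩⟧ : DirectLimit (fun k => (D.tower k).carrier) D.towerMap)
  map_one' := (DirectLimit.one_def (f := D.towerMap) k).symm
  map_mul' x y := (DirectLimit.mul_def (f := D.towerMap) k x y).symm
  map_zero' := (DirectLimit.zero_def (f := D.towerMap) k).symm
  map_add' x y := (DirectLimit.add_def (f := D.towerMap) k x y).symm

/-- The inclusion of `D` in its completion. -/
noncomputable def toCompletion (D : SplitPartialERing) : D.carrier →+* D.Completion :=
  D.ofLevel 0

theorem ofLevel_towerMap (D : SplitPartialERing) (i j : ℕ) (h : i ≤ j) (x : (D.tower i).carrier) :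
    D.ofLevel j (D.towerMap i j h x) = D.ofLevel i x :=
  (DirectLimit.eq_of_le (F := fun k => (D.tower k).carrier) (f := D.towerMap)
    (Sigma.mk i x) j h).symm

theorem towerExp_towerMap (D : SplitPartialERing) (i j : ℕ) (h : i ≤ j)
    (x : (D.tower i).carrier) :
    D.towerExp j (D.towerMap i j h x) =
      D.towerMap (i + 1) (j + 1) (Nat.succ_le_succ h) (D.towerExp i x) := by
  induction j, h using Nat.le_induction with
  | base => rw [towerMap_self, towerMap_self]
  | succ j h ih =>
    rw [towerMap_succ D i j h, towerMap_succ D (i + 1) (j + 1) (Nat.succ_le_succ h), ← ih,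
      towerExp_towerIncl]

/-- The exponential map of the completion: it sends an element `x` of the `k`-th ring of the chain
to the element `towerExp k x` of the `(k + 1)`-st ring. -/
noncomputable def completionExp (D : SplitPartialERing) : D.Completion → D.Completion :=
  DirectLimit.lift D.towerMap (fun k x => D.ofLevel (k + 1) (D.towerExp k x))
    (fun i j h x => by
      rw [towerExp_towerMap]
      exact (D.ofLevel_towerMap (i + 1) (j + 1) _ _).symm)

theorem completionExp_ofLevel (D : SplitPartialERing) (k : ℕ) (x : (D.tower k).carrier) :
    D.completionExp (D.ofLevel k x) = D.ofLevel (k + 1) (D.towerExp k x) := rfl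

noncomputable instance (D : SplitPartialERing) : ERing D.Completion where
  E := D.completionExp
  E_zero := by
    rw [← map_zero (D.ofLevel 0), completionExp_ofLevel, towerExp_zero, map_one]
  E_add a b := by
    refine DirectLimit.induction₂ (f := D.towerMap)
      (C := fun a b => D.completionExp (a + b : D.Completion)
        = D.completionExp a * D.completionExp b) (fun k x y => ?_) a b
    change D.completionExp (D.ofLevel k x + D.ofLevel k y) =
      D.completionExp (D.ofLevel k x) * D.completionExp (D.ofLevel k y)
    rw [← map_add, completionExp_ofLevel, completionExp_ofLevel, completionExp_ofLevel,
      towerExp_add, map_mul]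

end SplitPartialERing

/-! ### The ring of exponential polynomials -/

namespace EPolynomial

/-- The inclusion of the constants in the polynomial ring, as a `ℚ`-linear map. -/
noncomputable def constLinear (σ K : Type*) [CommRing K] [Algebra ℚ K] :
    K →ₗ[ℚ] MvPolynomial σ K where
  toFun := MvPolynomial.C
  map_add' := map_add _
  map_smul' c r := by
    rw [Algebra.smul_def, Algebra.smul_def, map_mul, RingHom.id_apply,
      MvPolynomial.algebraMap_apply]

/-- The constant coefficient, as a `ℚ`-linear map. -/
noncomputable def constCoeffLinear (σ K : Type*) [CommRing K] [Algebra ℚ K] :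
    MvPolynomial σ K →ₗ[ℚ] K where
  toFun := MvPolynomial.constantCoeff
  map_add' := map_add _
  map_smul' c r := by
    rw [Algebra.smul_def, Algebra.smul_def, map_mul, RingHom.id_apply,
      MvPolynomial.algebraMap_apply, MvPolynomial.constantCoeff_C]

/-- The polynomial ring `K[x]` as a partial E-ring: the exponential map is defined on the
constants only, and the chosen complement of the constants is the ideal generated by the
variables. -/
noncomputable def base (σ K : Type*) [CommRing K] [Algebra ℚ K] [ERing K] : SplitPartialERing where
  carrier := MvPolynomial σ K
  V := LinearMap.range (constLinear σ K)
  one_mem := ⟨1, by simp [constLinear]⟩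
  A := LinearMap.ker (constCoeffLinear σ K)
  isCompl := by
    have key (r : K) : constCoeffLinear σ K (constLinear σ K r) = r := by
      simp [constCoeffLinear, constLinear]
    rw [isCompl_iff, Submodule.disjoint_def, codisjoint_iff, eq_top_iff]
    constructor
    · rintro _ ⟨r, rfl⟩ h
      rw [LinearMap.mem_ker, key] at h
      simp [h]
    · intro f _
      refine Submodule.mem_sup.2 ⟨constLinear σ K (constCoeffLinear σ K f), ⟨_, rfl⟩,
        f - constLinear σ K (constCoeffLinear σ K f), ?_, by abel⟩
      rw [LinearMap.mem_ker, map_sub, key, sub_self]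
  E v := MvPolynomial.C (ERing.E (constCoeffLinear σ K v))
  E_zero := by simp [ERing.E_zero]
  E_add v w := by simp [ERing.E_add]

end EPolynomial

/-- The ring `K[x]^E` of exponential polynomials over the E-ring `K` in the variables `x_i`,
`i : σ`. -/
abbrev EPolynomial (σ K : Type*) [CommRing K] [Algebra ℚ K] [ERing K] : Type _ :=
  (EPolynomial.base σ K).Completion

namespace EPolynomial

/-- The inclusion of the polynomial ring `K[x]` in `K[x]^E`. -/
noncomputable def ofPoly (σ K : Type*) [CommRing K] [Algebra ℚ K] [ERing K] :
    MvPolynomial σ K →+* EPolynomial σ K :=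
  (base σ K).toCompletion

/-- The variable `x_i` in `K[x]^E`. -/
noncomputable def X {σ : Type*} (K : Type*) [CommRing K] [Algebra ℚ K] [ERing K] (i : σ) :
    EPolynomial σ K :=
  ofPoly σ K (MvPolynomial.X i)

/-- For `p ∈ K[x, y]`, where `x_i` is the variable `Sum.inl i` and `y_i` is the variable
`Sum.inr i`, the exponential polynomial `p(x, E(x))`. -/
noncomputable def substExp (σ K : Type*) [CommRing K] [Algebra ℚ K] [ERing K] :
    MvPolynomial (σ ⊕ σ) K →+* EPolynomial σ K :=
  MvPolynomial.eval₂Hom ((ofPoly σ K).comp MvPolynomial.C)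
    (Sum.elim (fun i => X K i) (fun i => ERing.E (X K i)))

end EPolynomial

/-! ### Fractional powers of the variables `y` -/

/-- The inclusion of `ℂ[x, y]` in `ℂ[x, y^ℚ]`, the group ring over `ℂ[x]` of `ℚ^n`, in which
`AddMonoidAlgebra.single q 1` is the monomial `y^q`. -/
noncomputable def toRatPowers (n : ℕ) :
    MvPolynomial (Fin n ⊕ Fin n) ℂ →+*
      AddMonoidAlgebra (MvPolynomial (Fin n) ℂ) (Fin n → ℚ) :=
  MvPolynomial.eval₂Hom (AddMonoidAlgebra.singleZeroRingHom.comp MvPolynomial.C)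
    (Sum.elim (fun i => AddMonoidAlgebra.single 0 (MvPolynomial.X i))
      (fun i => AddMonoidAlgebra.single (Pi.single i 1) 1))

/-- The element `y^q - a` of `ℂ[x, y^ℚ]`. -/
noncomputable def ratMonomialSub {n : ℕ} (q : Fin n → ℚ) (a : ℂ) :
    AddMonoidAlgebra (MvPolynomial (Fin n) ℂ) (Fin n → ℚ) :=
  AddMonoidAlgebra.single q 1 - AddMonoidAlgebra.single 0 (MvPolynomial.C a)

/-- The inclusion of `ℂ[x, y]` in `ℂ[x, y^(1/m)]`. The latter is the polynomial ring in the
variables `x_i` (`Sum.inl i`) and `z_i = y_i^(1/m)` (`Sum.inr i`), and `y_i = z_i^m`. -/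
noncomputable def toRoots (n m : ℕ) :
    MvPolynomial (Fin n ⊕ Fin n) ℂ →+* MvPolynomial (Fin n ⊕ Fin n) ℂ :=
  MvPolynomial.eval₂Hom MvPolynomial.C
    (Sum.elim (fun i => MvPolynomial.X (Sum.inl i)) (fun i => MvPolynomial.X (Sum.inr i) ^ m))

/-- The extension `I_m` of an ideal `I` of `ℂ[x, y]` to `ℂ[x, y^(1/m)]`. -/
noncomputable def rootExtension {n : ℕ} (m : ℕ) (I : Ideal (MvPolynomial (Fin n ⊕ Fin n) ℂ)) :
    Ideal (MvPolynomial (Fin n ⊕ Fin n) ℂ) :=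
  I.map (toRoots n m)

/-- The linear polynomial `a + q · x` of `ℂ[x, y]`. -/
noncomputable def affineForm {n : ℕ} (a : ℂ) (q : Fin n → ℚ) :
    MvPolynomial (Fin n ⊕ Fin n) ℂ :=
  MvPolynomial.C a + ∑ i, MvPolynomial.C (q i : ℂ) * MvPolynomial.X (Sum.inl i)

namespace SplitPartialERing

/-! ### The completion of a domain is a domain -/

/-! The ideal `J` is the kernel of a homomorphism of E-rings into a domain. Let `P` be the ideal
generated by `I` in ℂ[x, y^ℚ]. It is prime (`isPrime_map_toRatPowers`), so R = ℂ[x, y^ℚ]/P is a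
domain. On R put the partial exponential E(a + q·x) = exp(a)·y^q; this is well defined because the
class of a + q·x determines (a, q) (`affineMk_injective`). The free completion of R is built from
iterated group rings with exponents in ℚ-vector spaces, so it is still a domain
(`isDomain_completion`).

Sending x_i to its class extends to a homomorphism of E-rings `toGeneric` from ℂ[x]^E to this
completion. It sends E(x_i) to y_i, so its kernel is a prime E-ideal containing the generators of
`J`. Conversely, if an E-ideal L contains these generators, then y^q ↦ E(q·x) induces a map from R
to ℂ[x]^E/L that respects the partial exponential. It extends to the completion, and by uniqueness
its composite with `toGeneric` is the quotient map; hence the kernel lies in L (`ker_toGeneric_le`).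

For the primality of `P`: up to a monomial unit, every element of ℂ[x, y^ℚ] lies in some ℂ[x,
y^(1/m)], where condition 4 applies. That no power of y_1^(1/m)⋯y_n^(1/m) lies in I_m follows by
taking m-th roots of the y-coordinates of a generic point of `I` (`exists_prime_over`). -/

theorem incl_injective (D : SplitPartialERing) : Function.Injective D.incl :=
  fun x y h => by
    have := congrArg D.coeffZero h
    rwa [show D.incl x = D.inclLinear x from rfl, show D.incl y = D.inclLinear y from rfl,
      coeffZero_inclLinear, coeffZero_inclLinear] at this

/-- The exponent group is a ℚ-vector space, hence has unique sums, so its group ring over a domain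
has no zero divisors. -/
instance isDomain_next (D : SplitPartialERing) [IsDomain D.carrier] : IsDomain D.next.carrier :=
  inferInstanceAs (IsDomain (AddMonoidAlgebra D.carrier D.A))

theorem isDomain_tower (D : SplitPartialERing) [IsDomain D.carrier] (k : ℕ) :
    IsDomain (D.tower k).carrier := by
  induction k with
  | zero => assumption
  | succ k ih => exact isDomain_next _

theorem towerMap_injective (D : SplitPartialERing) (i j : ℕ) (h : i ≤ j) :
    Function.Injective (D.towerMap i j h) := by
  induction j, h using Nat.le_induction with
  | base => exact fun x y h => by rwa [towerMap_self, towerMap_self] at h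
  | succ j h ih =>
    intro x y hxy
    rw [towerMap_succ D i j h, towerMap_succ D i j h] at hxy
    exact ih (incl_injective _ hxy)

theorem ofLevel_injective (D : SplitPartialERing) (k : ℕ) : Function.Injective (D.ofLevel k) :=
  DirectLimit.mk_injective (f := D.towerMap) (fun i j h => D.towerMap_injective i j h) k

theorem toCompletion_injective (D : SplitPartialERing) : Function.Injective D.toCompletion :=
  D.ofLevel_injective 0

theorem exists_ofLevel₂ (D : SplitPartialERing) (a b : D.Completion) :
    ∃ k x y, a = D.ofLevel k x ∧ b = D.ofLevel k y :=
  DirectLimit.exists_eq_mk₂ (f := D.towerMap) a b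

theorem exists_ofLevel (D : SplitPartialERing) (a : D.Completion) :
    ∃ k x, a = D.ofLevel k x :=
  DirectLimit.exists_eq_mk (f := D.towerMap) a

instance isDomain_completion (D : SplitPartialERing) [IsDomain D.carrier] :
    IsDomain D.Completion := by
  have : NoZeroDivisors D.Completion := by
    refine ⟨fun {a b} hab => ?_⟩
    obtain ⟨k, x, y, rfl, rfl⟩ := D.exists_ofLevel₂ a b
    have := D.isDomain_tower k
    rw [← map_mul, map_eq_zero_iff _ (D.ofLevel_injective k)] at hab
    exact (mul_eq_zero.1 hab).imp (fun h => by rw [h, map_zero]) (fun h => by rw [h, map_zero])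
  have : Nontrivial D.Completion := D.toCompletion_injective.nontrivial
  exact NoZeroDivisors.to_isDomain _

/-! ### The universal property of the completion -/

theorem expNext_of_mem_V (D : SplitPartialERing) (v : D.V) :
    D.expNext v = AddMonoidAlgebra.single 0 (D.E v) := by
  rw [expNext, Submodule.projectionOnto_apply_left,
    (Submodule.projectionOnto_apply_eq_zero_iff _).2 v.2]

/-- Each new generator of the next ring is thus an exponential of an old element; this gives
uniqueness of E-homomorphisms on the completion. -/
theorem expNext_of_mem_A (D : SplitPartialERing) (a : D.A) :
    D.expNext a = AddMonoidAlgebra.single a 1 := by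
  rw [expNext, Submodule.projectionOnto_apply_left,
    (Submodule.projectionOnto_apply_eq_zero_iff _).2 a.2, D.E_zero]

theorem E_ofLevel (D : SplitPartialERing) (k : ℕ) (x : (D.tower k).carrier) :
    ERing.E (D.ofLevel k x) = D.ofLevel (k + 1) (D.towerExp k x) := rfl

theorem ofLevel_towerIncl (D : SplitPartialERing) (k : ℕ) (x : (D.tower k).carrier) :
    D.ofLevel (k + 1) (D.towerIncl k x) = D.ofLevel k x := by
  rw [← D.ofLevel_towerMap k (k + 1) k.le_succ x, towerMap_succ D k k le_rfl, towerMap_self]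

/-- The exponential map of the completion extends the one of the partial E-ring. -/
theorem E_toCompletion (D : SplitPartialERing) (v : D.V) :
    ERing.E (D.toCompletion v) = D.toCompletion (D.E v) := by
  refine Eq.trans ?_ (D.ofLevel_towerIncl 0 (D.E v))
  exact congrArg (D.ofLevel 1) (D.expNext_of_mem_V v)

/-- Two homomorphisms of E-rings on the completion that agree on `D` are equal. -/
theorem completion_hom_ext (D : SplitPartialERing) {S : Type*} [CommRing S] [ERing S]
    {f g : D.Completion →+* S} (hf : ∀ x, f (ERing.E x) = ERing.E (f x))
    (hg : ∀ x, g (ERing.E x) = ERing.E (g x))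
    (h : f.comp D.toCompletion = g.comp D.toCompletion) : f = g := by
  have key : ∀ k, f.comp (D.ofLevel k) = g.comp (D.ofLevel k) := by
    intro k
    induction k with
    | zero => exact h
    | succ k ih =>
      replace ih : ∀ x, f (D.ofLevel k x) = g (D.ofLevel k x) := fun x => congrArg (· x) ih
      -- Level k + 1 is a group ring over level k, so it suffices to compare coefficients and the
      -- t^a, and t^a = E(a).
      refine AddMonoidAlgebra.ringHom_ext (R := (D.tower k).carrier) (M := (D.tower k).A)
        (fun r => ?_) (fun a => ?_)
      · have := D.ofLevel_towerIncl k r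
        change f (D.ofLevel (k + 1) (D.towerIncl k r)) = g (D.ofLevel (k + 1) (D.towerIncl k r))
        rw [this, ih]
      · rw [← expNext_of_mem_A]
        change f (D.ofLevel (k + 1) (D.towerExp k a)) = g (D.ofLevel (k + 1) (D.towerExp k a))
        rw [← E_ofLevel, hf, hg, ih]
  ext x
  obtain ⟨k, y, rfl⟩ := D.exists_ofLevel x
  exact congrArg (· y) (key k)

section Lift

variable {S : Type*} [CommRing S] [ERing S]

/-- The extension of a ring homomorphism `φ` from `D` to an E-ring to the ring `D[t^A]`: the image
of `t ^ a` is `E (φ a)`. -/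
noncomputable def liftNext (D : SplitPartialERing) (φ : D.carrier →+* S) : D.next.carrier →+* S :=
  (AddMonoidAlgebra.liftNCRingHom φ
    { toFun := fun a => ERing.E (φ (a.toAdd : D.A))
      map_one' := by simp [ERing.E_zero]
      map_mul' := fun a b => by simp [ERing.E_add] }
    (fun _ _ => Commute.all _ _) : AddMonoidAlgebra D.carrier D.A →+* S)

theorem liftNext_single (D : SplitPartialERing) (φ : D.carrier →+* S) (a : D.A) (r : D.carrier) :
    D.liftNext φ (AddMonoidAlgebra.single a r : AddMonoidAlgebra D.carrier D.A) =
      φ r * ERing.E (φ a) :=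
  AddMonoidAlgebra.liftNCRingHom_single _ _ _ _ _

theorem liftNext_incl (D : SplitPartialERing) (φ : D.carrier →+* S) (r : D.carrier) :
    D.liftNext φ (D.incl r) = φ r := by
  refine (D.liftNext_single φ 0 r).trans ?_
  simp [ERing.E_zero]

/-- Split r = v + b along V ⊕ A: `hφ` handles E(v), the definition of the lift handles t^b, and
additivity of E recombines them. -/
theorem liftNext_exp (D : SplitPartialERing) (φ : D.carrier →+* S)
    (hφ : ∀ v : D.V, φ (D.E v) = ERing.E (φ v)) (r : D.carrier) :
    D.liftNext φ (D.exp r) = ERing.E (φ r) := by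
  refine (D.liftNext_single φ _ _).trans ?_
  rw [hφ, ← ERing.E_add, ← map_add, add_comm]
  congr 2
  rw [add_comm]
  rw [Submodule.coe_projectionOnto_apply, Submodule.coe_projectionOnto_apply]
  exact Submodule.projection_add_projection_eq_self D.isCompl r

/-- The compatibility assumed of φ is inherited by its lift, since the new domain of E is just the
old ring; this drives the induction along the chain. -/
theorem liftNext_E (D : SplitPartialERing) (φ : D.carrier →+* S)
    (hφ : ∀ v : D.V, φ (D.E v) = ERing.E (φ v)) (v : D.next.V) :
    D.liftNext φ (D.next.E v) = ERing.E (D.liftNext φ v) := by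
  obtain ⟨_, r, rfl⟩ := v
  refine (congrArg (fun s => D.liftNext φ (D.exp s)) (D.coeffZero_inclLinear r)).trans ?_
  refine (D.liftNext_exp φ hφ r).trans ?_
  exact congrArg ERing.E (D.liftNext_incl φ r).symm

/-- The extensions of a ring homomorphism from `D` to an E-ring to the rings of the chain. -/
noncomputable def liftTower (D : SplitPartialERing) (φ : D.carrier →+* S) :
    ∀ k, (D.tower k).carrier →+* S
  | 0 => φ
  | k + 1 => (D.tower k).liftNext (D.liftTower φ k)

theorem liftTower_E (D : SplitPartialERing) (φ : D.carrier →+* S)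
    (hφ : ∀ v : D.V, φ (D.E v) = ERing.E (φ v)) (k : ℕ) (v : (D.tower k).V) :
    D.liftTower φ k ((D.tower k).E v) = ERing.E (D.liftTower φ k v) := by
  induction k with
  | zero => exact hφ v
  | succ k ih => exact (D.tower k).liftNext_E _ ih v

theorem liftTower_towerMap (D : SplitPartialERing) (φ : D.carrier →+* S) (i j : ℕ) (h : i ≤ j)
    (x : (D.tower i).carrier) :
    D.liftTower φ j (D.towerMap i j h x) = D.liftTower φ i x := by
  induction j, h using Nat.le_induction with
  | base => rw [towerMap_self]
  | succ j h ih =>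
    rw [towerMap_succ D i j h, ← ih]
    exact (D.tower j).liftNext_incl _ _

/-- The extension of a ring homomorphism from `D` to an E-ring to the completion of `D`. -/
noncomputable def lift (D : SplitPartialERing) (φ : D.carrier →+* S) : D.Completion →+* S where
  toFun := DirectLimit.lift D.towerMap (fun k x => D.liftTower φ k x)
    (fun i j h x => (D.liftTower_towerMap φ i j h x).symm)
  map_one' := by
    rw [← map_one (D.ofLevel 0)]
    exact map_one (D.liftTower φ 0)
  map_zero' := by
    rw [← map_zero (D.ofLevel 0)]
    exact map_zero (D.liftTower φ 0)
  map_mul' a b := by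
    obtain ⟨k, x, y, rfl, rfl⟩ := D.exists_ofLevel₂ a b
    rw [← map_mul]
    exact map_mul (D.liftTower φ k) x y
  map_add' a b := by
    obtain ⟨k, x, y, rfl, rfl⟩ := D.exists_ofLevel₂ a b
    rw [← map_add]
    exact map_add (D.liftTower φ k) x y

theorem lift_ofLevel (D : SplitPartialERing) (φ : D.carrier →+* S) (k : ℕ)
    (x : (D.tower k).carrier) : D.lift φ (D.ofLevel k x) = D.liftTower φ k x := rfl

/-- The extension of a homomorphism of partial E-rings is a homomorphism of E-rings. -/
theorem lift_E (D : SplitPartialERing) (φ : D.carrier →+* S)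
    (hφ : ∀ v : D.V, φ (D.E v) = ERing.E (φ v)) (a : D.Completion) :
    D.lift φ (ERing.E a) = ERing.E (D.lift φ a) := by
  obtain ⟨k, x, rfl⟩ := D.exists_ofLevel a
  rw [E_ofLevel, lift_ofLevel, lift_ofLevel]
  exact (D.tower k).liftNext_exp _ (D.liftTower_E φ hφ k) x

end Lift

end SplitPartialERing

/-! ### The extension of an ideal to the ring with rational powers -/

theorem AddMonoidAlgebra.prod_single_one {R M ι : Type*} [CommSemiring R] [AddCommMonoid M]
    (s : Finset ι) (f : ι → M) :
    ∏ i ∈ s, (AddMonoidAlgebra.single (f i) 1 : AddMonoidAlgebra R M) =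
      AddMonoidAlgebra.single (∑ i ∈ s, f i) 1 := by
  classical
  induction s using Finset.induction_on with
  | empty => simp [AddMonoidAlgebra.one_def]
  | insert i s hi ih =>
    rw [Finset.prod_insert hi, Finset.sum_insert hi, ih, AddMonoidAlgebra.single_mul_single, one_mul]

namespace RatPowers

open MvPolynomial

/-- The ring `ℂ[x, y^ℚ]`. -/
abbrev Ring (n : ℕ) : Type := AddMonoidAlgebra (MvPolynomial (Fin n) ℂ) (Fin n → ℚ)

/-- The inclusion of `ℂ[x, y^(1/m)]` in `ℂ[x, y^ℚ]`. -/
noncomputable def ofRoots (n m : ℕ) : MvPolynomial (Fin n ⊕ Fin n) ℂ →+* Ring n :=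
  eval₂Hom (AddMonoidAlgebra.singleZeroRingHom.comp C)
    (Sum.elim (fun i => AddMonoidAlgebra.single 0 (X i))
      (fun i => AddMonoidAlgebra.single (Pi.single i (m : ℚ)⁻¹) 1))

/-! ### Embedding ℂ[x, y^(1/m)] in ℂ[x, y^ℚ] and clearing denominators -/

section Basic

variable {n m : ℕ}

@[simp]
theorem ofRoots_C (c : ℂ) : ofRoots n m (C c) = AddMonoidAlgebra.single 0 (C c) := by
  simp [ofRoots]

@[simp]
theorem ofRoots_X_inl (i : Fin n) :
    ofRoots n m (X (Sum.inl i)) = AddMonoidAlgebra.single 0 (X i) := by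
  simp [ofRoots]

@[simp]
theorem ofRoots_X_inr (i : Fin n) :
    ofRoots n m (X (Sum.inr i)) = AddMonoidAlgebra.single (Pi.single i (m : ℚ)⁻¹) 1 := by
  simp [ofRoots]

theorem ofRoots_rename_inl (p : MvPolynomial (Fin n) ℂ) :
    ofRoots n m (rename Sum.inl p) = AddMonoidAlgebra.single 0 p := by
  have : (ofRoots n m).comp (rename Sum.inl : MvPolynomial (Fin n) ℂ →ₐ[ℂ] _).toRingHom =
      AddMonoidAlgebra.singleZeroRingHom := by
    refine MvPolynomial.ringHom_ext (fun r => ?_) (fun i => ?_) <;> simp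
  exact congrArg (· p) this

theorem ofRoots_comp_toRoots (hm : 0 < m) : (ofRoots n m).comp (toRoots n m) = toRatPowers n := by
  have hm' : (m : ℚ) ≠ 0 := by positivity
  refine MvPolynomial.ringHom_ext (fun r => ?_) (fun i => ?_)
  · simp [toRoots, toRatPowers]
  · rcases i with i | i
    · simp [toRoots, toRatPowers]
    · simp only [toRoots, toRatPowers, RingHom.comp_apply, coe_eval₂Hom, eval₂_X, Sum.elim_inr,
        map_pow, ofRoots_X_inr, AddMonoidAlgebra.single_pow, one_pow]
      rw [← Pi.single_smul]
      simp [hm']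

/-- Viewed as polynomials in the roots with coefficients in ℂ[x], the map only relabels exponents by
s ↦ s/m, which is injective for m > 0. The swap makes the y-variables the outer ones in
`sumAlgEquiv`. -/
theorem ofRoots_injective (hm : 0 < m) : Function.Injective (ofRoots n m) := by
  let e : (Fin n →₀ ℕ) →+ (Fin n → ℚ) :=
    { toFun := fun s i => (s i : ℚ) * (m : ℚ)⁻¹
      map_zero' := by ext; simp
      map_add' := fun s t => by ext; simp [add_mul] }
  have he : Function.Injective e := fun s t h => by
    have hm' : (m : ℚ) ≠ 0 := by positivity
    ext i
    simpa [e, hm'] using congrFun h i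
  have key : ofRoots n m = ((AddMonoidAlgebra.mapDomainRingHom (MvPolynomial (Fin n) ℂ) e).comp
      (sumAlgEquiv ℂ (Fin n) (Fin n)).toAlgHom.toRingHom).comp
        (rename Sum.swap : MvPolynomial (Fin n ⊕ Fin n) ℂ →ₐ[ℂ] _).toRingHom := by
    refine MvPolynomial.ringHom_ext (fun r => ?_) (fun i => ?_)
    · simp only [ofRoots_C, AlgHom.toRingHom_eq_coe, RingHom.comp_apply, RingHom.coe_coe,
        rename_C, AlgEquiv.coe_toAlgHom, sumAlgEquiv_C_inl]
      rw [show (C (C r) : MvPolynomial (Fin n) (MvPolynomial (Fin n) ℂ)) =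
        AddMonoidAlgebra.single 0 (C r) from rfl]
      simp
    · rcases i with i | i
      · simp only [ofRoots_X_inl, AlgHom.toRingHom_eq_coe, RingHom.comp_apply, RingHom.coe_coe,
          rename_X, Sum.swap_inl, AlgEquiv.coe_toAlgHom, sumAlgEquiv_X_inr]
        rw [show (C (X i) : MvPolynomial (Fin n) (MvPolynomial (Fin n) ℂ)) =
          AddMonoidAlgebra.single 0 (X i) from rfl]
        simp
      · simp only [ofRoots_X_inr, AlgHom.toRingHom_eq_coe, RingHom.comp_apply, RingHom.coe_coe,
          rename_X, Sum.swap_inr, AlgEquiv.coe_toAlgHom, sumAlgEquiv_X_inl]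
        rw [X, monomial]
        simp only [AddMonoidAlgebra.lsingle_apply, AddMonoidAlgebra.mapDomainRingHom_apply,
          AddMonoidAlgebra.mapDomain_single]
        congr 1
        ext j
        by_cases h : j = i
        · subst h; simp [e]
        · simp [e, h]
  rw [key]
  exact (AddMonoidAlgebra.mapDomain_injective he).comp
    ((sumAlgEquiv ℂ (Fin n) (Fin n)).injective.comp
      (rename_injective _ Sum.swap_leftInverse.injective))

variable (n) in
/-- The monomial `(y_1 ⋯ y_n) ^ N`. -/
noncomputable def yPow (N : ℕ) : Ring n := AddMonoidAlgebra.single (fun _ => (N : ℚ)) 1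

theorem yPow_add (N M : ℕ) : yPow n (N + M) = yPow n N * yPow n M := by
  rw [yPow, yPow, yPow, AddMonoidAlgebra.single_mul_single, one_mul]
  congr 1
  ext; simp

theorem yPow_zero : yPow n 0 = 1 := by
  rw [yPow, AddMonoidAlgebra.one_def]
  congr 1

theorem isUnit_yPow (N : ℕ) : IsUnit (yPow n N) := by
  refine IsUnit.of_mul_eq_one (AddMonoidAlgebra.single (fun _ => -(N : ℚ)) 1) ?_
  rw [yPow, AddMonoidAlgebra.single_mul_single, one_mul, AddMonoidAlgebra.one_def]
  congr 1
  ext; simp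

variable (n) in
/-- The product of the variables `y_i^(1/m)`. -/
noncomputable def rootProd : MvPolynomial (Fin n ⊕ Fin n) ℂ := ∏ i, X (Sum.inr i)

theorem ofRoots_prod (e : Fin n → ℕ) :
    ofRoots n m (∏ i, X (Sum.inr i) ^ e i) =
      AddMonoidAlgebra.single (fun i => (e i : ℚ) * (m : ℚ)⁻¹) 1 := by
  simp only [map_prod, map_pow, ofRoots_X_inr, AddMonoidAlgebra.single_pow, one_pow]
  rw [AddMonoidAlgebra.prod_single_one]
  congr 1
  ext i
  simp [Finset.sum_apply, Pi.single_apply]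

theorem ofRoots_rootProd_pow (hm : 0 < m) (N : ℕ) :
    ofRoots n m (rootProd n ^ (m * N)) = yPow n N := by
  have hm' : (m : ℚ) ≠ 0 := by positivity
  rw [rootProd, ← Finset.prod_pow, ofRoots_prod, yPow]
  congr 1
  ext i
  push_cast
  field_simp

/-- The ideals `K m` of the rings `ℂ[x, y^(1/m)]` represent `f` if, for all sufficiently divisible
`m`, some `f * (y_1 ⋯ y_n) ^ N` lies in the image of `K m`. -/
def Represents (K : ℕ → Ideal (MvPolynomial (Fin n ⊕ Fin n) ℂ)) (f : Ring n) : Prop :=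
  ∃ m₀, 0 < m₀ ∧ ∀ m, 0 < m → m₀ ∣ m → ∃ N, ∃ H ∈ K m, f * yPow n N = ofRoots n m H

variable {K : ℕ → Ideal (MvPolynomial (Fin n ⊕ Fin n) ℂ)}

theorem represents_zero : Represents K (0 : Ring n) :=
  ⟨1, one_pos, fun m _ _ => ⟨0, 0, zero_mem _, by simp⟩⟩

/-- Asking for all multiples of `m₀` lets two elements be treated at one common m; the two monomial
factors are then equalised inside ℂ[x, y^(1/m)]. -/
theorem Represents.add {f g : Ring n} (hf : Represents K f) (hg : Represents K g) :
    Represents K (f + g) := by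
  obtain ⟨a, ha, hf⟩ := hf
  obtain ⟨b, hb, hg⟩ := hg
  refine ⟨a * b, by positivity, fun m hm h => ?_⟩
  obtain ⟨N, F, hF, hfF⟩ := hf m hm ((dvd_mul_right _ _).trans h)
  obtain ⟨M, G, hG, hgG⟩ := hg m hm ((dvd_mul_left _ _).trans h)
  refine ⟨N + M, rootProd n ^ (m * M) * F + rootProd n ^ (m * N) * G,
    add_mem (Ideal.mul_mem_left _ _ hF) (Ideal.mul_mem_left _ _ hG), ?_⟩
  rw [map_add, map_mul, map_mul, ofRoots_rootProd_pow hm, ofRoots_rootProd_pow hm, ← hfF, ← hgG,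
    yPow_add]
  ring

/-- With K = ⊤ the condition on `f` only says that its denominators can be cleared. Once
`represents_top` is known, this makes the represented elements an ideal. -/
theorem Represents.mul_left {f g : Ring n} (hf : Represents (fun _ => ⊤) f)
    (hg : Represents K g) : Represents K (f * g) := by
  obtain ⟨a, ha, hf⟩ := hf
  obtain ⟨b, hb, hg⟩ := hg
  refine ⟨a * b, by positivity, fun m hm h => ?_⟩
  obtain ⟨N, F, hF, hfF⟩ := hf m hm ((dvd_mul_right _ _).trans h)
  obtain ⟨M, G, hG, hgG⟩ := hg m hm ((dvd_mul_left _ _).trans h)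
  refine ⟨N + M, F * G, Ideal.mul_mem_left _ _ hG, ?_⟩
  rw [map_mul, ← hfF, ← hgG, yPow_add]
  ring

theorem represents_single (q : Fin n → ℚ) (c : MvPolynomial (Fin n) ℂ) :
    Represents (fun _ => ⊤) (AddMonoidAlgebra.single q c : Ring n) := by
  -- The product of the denominators makes every q_i·m an integer.
  refine ⟨∏ i, (q i).den, Finset.prod_pos fun i _ => (q i).den_pos, fun m hm h => ?_⟩
  have hm' : (m : ℚ) ≠ 0 := by positivity
  -- This N bounds every |q_i|, so all exponents q_i + N are nonnegative.
  let N := ∑ i, (q i).num.natAbs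
  have : ∀ i, ∃ e : ℕ, (e : ℚ) = (q i + N) * m := by
    intro i
    obtain ⟨k, hk⟩ := (Finset.dvd_prod_of_mem _ (Finset.mem_univ i)).trans h
    have hN : (q i).num.natAbs ≤ N :=
      Finset.single_le_sum (f := fun i => (q i).num.natAbs) (fun _ _ => Nat.zero_le _)
        (Finset.mem_univ i)
    have hd := (q i).den_pos
    have hnn : 0 ≤ (q i).num + N * (q i).den := by
      have h₁ : -(N : ℤ) ≤ (q i).num := by omega
      have h₂ : (1 : ℤ) ≤ (q i).den := by omega
      nlinarith
    obtain ⟨e, he⟩ := Int.eq_ofNat_of_zero_le hnn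
    refine ⟨e * k, ?_⟩
    have he' : ((q i).num : ℚ) + N * (q i).den = e := by exact_mod_cast he
    have hq : q i * (q i).den = (q i).num := Rat.mul_den_eq_num _
    rw [hk]
    push_cast
    rw [← he', ← hq]
    ring
  choose e he using this
  refine ⟨N, rename Sum.inl c * ∏ i, X (Sum.inr i) ^ e i, trivial, ?_⟩
  rw [map_mul, ofRoots_rename_inl, ofRoots_prod, yPow, AddMonoidAlgebra.single_mul_single,
    AddMonoidAlgebra.single_mul_single, mul_one, zero_add]
  congr 1
  ext i
  rw [he]
  simp [hm']

theorem represents_top (f : Ring n) : Represents (fun _ => ⊤) f := by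
  induction f using AddMonoidAlgebra.induction_linear with
  | zero => exact represents_zero
  | add f g hf hg => exact hf.add hg
  | single q c => exact represents_single q c

end Basic

/-! ### Contraction and primality of the extended ideal -/

section Ideal

variable {n : ℕ} {I : Ideal (MvPolynomial (Fin n ⊕ Fin n) ℂ)}

/-- The represented elements form an ideal, and generators from `I` need no clearing. This reduces
membership in the extension to membership in I_m. -/
theorem represents_of_mem_map {f : Ring n} (hf : f ∈ I.map (toRatPowers n)) :
    Represents (fun m => rootExtension m I) f := by
  induction hf using Submodule.span_induction with
  | mem x hx =>
    obtain ⟨p, hp, rfl⟩ := hx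
    refine ⟨1, one_pos, fun m hm _ => ⟨0, toRoots n m p, Ideal.mem_map_of_mem _ hp, ?_⟩⟩
    rw [yPow_zero, mul_one, ← ofRoots_comp_toRoots hm, RingHom.comp_apply]
  | zero => exact represents_zero
  | add f g _ _ hf hg => exact hf.add hg
  | smul a f _ hf => exact (represents_top a).mul_left hf

theorem ofRoots_mem_map {m : ℕ} (hm : 0 < m) {H : MvPolynomial (Fin n ⊕ Fin n) ℂ}
    (hH : H ∈ rootExtension m I) : ofRoots n m H ∈ I.map (toRatPowers n) := by
  rw [← ofRoots_comp_toRoots hm, ← Ideal.map_map]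
  exact Ideal.mem_map_of_mem _ hH

/-- If `I` is prime and contains no `y_i`, a point of `I` over an algebraically closed field lifts
along `y_i ↦ y_i^m`. -/
theorem exists_prime_over (hI : I.IsPrime) (hy : ∀ i, X (Sum.inr i) ∉ I) {m : ℕ} (hm : 0 < m) :
    ∃ P : Ideal (MvPolynomial (Fin n ⊕ Fin n) ℂ), P.IsPrime ∧ P.comap (toRoots n m) = I ∧
      ∀ i, X (Sum.inr i) ∉ P := by
  -- The map `φ` below is the generic point of `I` with coordinates in an algebraically closed
  -- field; its kernel is exactly `I`.
  let F := AlgebraicClosure (FractionRing (MvPolynomial (Fin n ⊕ Fin n) ℂ ⧸ I))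
  let φ : MvPolynomial (Fin n ⊕ Fin n) ℂ →+* F :=
    ((algebraMap (FractionRing (MvPolynomial (Fin n ⊕ Fin n) ℂ ⧸ I)) F).comp
      (algebraMap (MvPolynomial (Fin n ⊕ Fin n) ℂ ⧸ I) _)).comp (Ideal.Quotient.mk I)
  have hφ (p) : φ p = 0 ↔ p ∈ I := by
    rw [← Ideal.Quotient.eq_zero_iff_mem]
    have h₁ := IsFractionRing.injective (MvPolynomial (Fin n ⊕ Fin n) ℂ ⧸ I)
      (FractionRing (MvPolynomial (Fin n ⊕ Fin n) ℂ ⧸ I))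
    have h₂ := (algebraMap (FractionRing (MvPolynomial (Fin n ⊕ Fin n) ℂ ⧸ I)) F).injective
    exact (map_eq_zero_iff _ h₂).trans (map_eq_zero_iff _ h₁)
  choose z hz using fun i : Fin n =>
    IsAlgClosed.exists_pow_nat_eq (φ (X (Sum.inr i))) hm
  let ψ : MvPolynomial (Fin n ⊕ Fin n) ℂ →+* F :=
    eval₂Hom (φ.comp C) (Sum.elim (fun i => φ (X (Sum.inl i))) z)
  have hψ : ψ.comp (toRoots n m) = φ := by
    refine MvPolynomial.ringHom_ext (fun r => ?_) (fun i => ?_)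
    · simp [toRoots, ψ]
    · rcases i with i | i <;> simp [toRoots, ψ, hz]
  refine ⟨RingHom.ker ψ, RingHom.ker_isPrime ψ, ?_, fun i hi => hy i ?_⟩
  · ext p
    rw [Ideal.mem_comap, RingHom.mem_ker, ← RingHom.comp_apply, hψ, hφ]
  -- A vanishing root would make y_i vanish at the generic point, that is, y_i ∈ I.
  · have : z i = 0 := by simpa [ψ, RingHom.mem_ker] using hi
    rw [← hφ, ← hz, this, zero_pow hm.ne']

/-- The prime `P` over `I` contains I_m but none of the y_i^(1/m). -/
theorem rootProd_pow_notMem (hI : I.IsPrime) (hy : ∀ i, X (Sum.inr i) ∉ I) {m : ℕ} (hm : 0 < m)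
    (k : ℕ) : rootProd n ^ k ∉ rootExtension m I := by
  obtain ⟨P, hP, hPI, hPy⟩ := exists_prime_over hI hy hm
  intro h
  have h := hP.mem_of_pow_mem _ (Ideal.map_le_iff_le_comap.2 hPI.ge h)
  obtain ⟨i, -, hi⟩ := (Ideal.IsPrime.prod_mem_iff (p := P)).1 h
  exact hPy i hi

/-- If p lies in the extension, then p times a monomial in the y_i lies in I_m, hence in the prime
`P` over `I`. The monomial is not in `P`, so p is, and `P` contracts to `I`. -/
theorem comap_map_toRatPowers (hI : I.IsPrime) (hy : ∀ i, X (Sum.inr i) ∉ I) :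
    (I.map (toRatPowers n)).comap (toRatPowers n) = I := by
  refine le_antisymm (fun p hp => ?_) Ideal.le_comap_map
  obtain ⟨m, hm, h⟩ := represents_of_mem_map (Ideal.mem_comap.1 hp)
  obtain ⟨N, H, hH, h⟩ := h m hm dvd_rfl
  obtain ⟨P, hP, hPI, hPy⟩ := exists_prime_over hI hy hm
  rw [← ofRoots_comp_toRoots hm, RingHom.comp_apply, ← ofRoots_rootProd_pow hm, ← map_mul] at h
  have h := ofRoots_injective hm h
  rw [← hPI, Ideal.mem_comap]
  have hHP : H ∈ P := Ideal.map_le_iff_le_comap.2 hPI.ge hH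
  rw [← h] at hHP
  refine (hP.mem_or_mem hHP).resolve_right fun h => ?_
  obtain ⟨i, -, hi⟩ := (Ideal.IsPrime.prod_mem_iff (p := P)).1 (hP.mem_of_pow_mem _ h)
  exact hPy i hi

/-- Clear the denominators of f, g and fg at one m. Primality of I_m puts the numerator of f or of g
in I_m, and monomials are units in ℂ[x, y^ℚ]. -/
theorem isPrime_map_toRatPowers (hI : I.IsPrime) (hy : ∀ i, X (Sum.inr i) ∉ I)
    (hroot : ∀ m : ℕ, 0 < m → (rootExtension m I).IsPrime) :
    (I.map (toRatPowers n)).IsPrime := by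
  refine ⟨fun h => hI.ne_top ?_, fun {f g} hfg => ?_⟩
  · rw [← comap_map_toRatPowers hI hy, h, Ideal.comap_top]
  obtain ⟨a, ha, hf⟩ := represents_top f
  obtain ⟨b, hb, hg⟩ := represents_top g
  obtain ⟨c, hc, hfg⟩ := represents_of_mem_map hfg
  let m := a * b * c
  have hm : 0 < m := by positivity
  obtain ⟨N, F, -, hF⟩ := hf m hm ⟨b * c, by ring⟩
  obtain ⟨M, G, -, hG⟩ := hg m hm ⟨a * c, by ring⟩
  obtain ⟨L, H, hH, hFG⟩ := hfg m hm ⟨a * b, by ring⟩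
  -- Both sides equal f·g·(y_1⋯y_n)^(N+M+L).
  have key : ofRoots n m (F * G * rootProd n ^ (m * L)) =
      ofRoots n m (H * rootProd n ^ (m * (N + M))) := by
    rw [map_mul, map_mul, map_mul, ofRoots_rootProd_pow hm, ofRoots_rootProd_pow hm, ← hF, ← hG,
      ← hFG, yPow_add]
    ring
  have hmem : F * G * rootProd n ^ (m * L) ∈ rootExtension m I := by
    rw [ofRoots_injective hm key]
    exact Ideal.mul_mem_right _ _ hH
  have hp := hroot m hm
  have hmem := (hp.mem_or_mem hmem).resolve_right (rootProd_pow_notMem hI hy hm _)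
  have descend {f : Ring n} {N : ℕ} {F} (h : f * yPow n N = ofRoots n m F)
      (hF : F ∈ rootExtension m I) : f ∈ I.map (toRatPowers n) := by
    rw [← Ideal.mul_unit_mem_iff_mem _ (isUnit_yPow N), h]
    exact ofRoots_mem_map hm hF
  exact (hp.mem_or_mem hmem).imp (descend hF) (descend hG)

end Ideal

end RatPowers

/-! ### Quotients by E-ideals -/

/-- This makes E descend to the quotient: E(a) − E(b) is a multiple of E(a − b) − 1. -/
theorem IsEIdeal.mk_E_eq {R : Type*} [CommRing R] [ERing R] {L : Ideal R} (hL : IsEIdeal L)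
    {a b : R} (h : Ideal.Quotient.mk L a = Ideal.Quotient.mk L b) :
    Ideal.Quotient.mk L (ERing.E a) = Ideal.Quotient.mk L (ERing.E b) := by
  rw [Ideal.Quotient.mk_eq_mk_iff_sub_mem] at h ⊢
  have key : ERing.E a - ERing.E b = ERing.E b * (ERing.E (a - b) - 1) := by
    rw [mul_sub, ← ERing.E_add, mul_one, add_sub_cancel]
  rw [key]
  exact L.mul_mem_left _ (hL _ h)

/-- The quotient of an E-ring by an E-ideal is an E-ring. -/
@[reducible]
noncomputable def IsEIdeal.quotientERing {R : Type*} [CommRing R] [ERing R] {L : Ideal R}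
    (hL : IsEIdeal L) : ERing (R ⧸ L) where
  E x := Ideal.Quotient.mk L (ERing.E (Quotient.out x))
  E_zero := by
    rw [hL.mk_E_eq (b := 0) (by rw [Ideal.Quotient.mk_out, map_zero]), ERing.E_zero, map_one]
  E_add x y := by
    rw [hL.mk_E_eq (b := Quotient.out x + Quotient.out y)
      (by simp only [map_add, Ideal.Quotient.mk_out]), ERing.E_add, map_mul]

theorem IsEIdeal.mk_E {R : Type*} [CommRing R] [ERing R] {L : Ideal R} (hL : IsEIdeal L) (a : R) :
    Ideal.Quotient.mk L (ERing.E a) = hL.quotientERing.E (Ideal.Quotient.mk L a) :=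
  hL.mk_E_eq (Ideal.Quotient.mk_out _).symm

theorem isEIdeal_ker {R S : Type*} [CommRing R] [ERing R] [CommRing S] [ERing S] {f : R →+* S}
    (hf : ∀ x, f (ERing.E x) = ERing.E (f x)) : IsEIdeal (RingHom.ker f) := fun a ha => by
  rw [RingHom.mem_ker] at ha ⊢
  rw [map_sub, hf, ha, ERing.E_zero, map_one, sub_self]

/-! ### Partial E-rings from parametrizations of the domain -/

namespace SplitPartialERing

/-- The partial E-ring on `R` whose exponential map is defined on the image of an injective linear
map `f`, by `E (f w) = e w`. -/
noncomputable def ofInjective {W R : Type*} [AddCommGroup W] [Module ℚ W] [CommRing R] [Algebra ℚ R]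
    (f : W →ₗ[ℚ] R) (hf : Function.Injective f) (hone : ∃ w, f w = 1) (e : W → R)
    (e_zero : e 0 = 1) (e_add : ∀ v w, e (v + w) = e v * e w) : SplitPartialERing where
  carrier := R
  V := LinearMap.range f
  one_mem := hone
  -- Any complement will do: the universal property of the completion refers only to V and E.
  A := (Submodule.exists_isCompl (LinearMap.range f)).choose
  isCompl := (Submodule.exists_isCompl (LinearMap.range f)).choose_spec
  E v := e ((LinearEquiv.ofInjective f hf).symm v)
  E_zero := by rw [map_zero, e_zero]
  E_add v w := by rw [map_add, e_add]

theorem ofInjective_E {W R : Type*} [AddCommGroup W] [Module ℚ W] [CommRing R] [Algebra ℚ R]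
    (f : W →ₗ[ℚ] R) (hf : Function.Injective f) (hone : ∃ w, f w = 1) (e : W → R)
    (e_zero : e 0 = 1) (e_add : ∀ v w, e (v + w) = e v * e w) (w : W) :
    (ofInjective f hf hone e e_zero e_add).E ⟨f w, ⟨w, rfl⟩⟩ = e w :=
  congrArg e ((LinearEquiv.symm_apply_eq _).2 rfl)

end SplitPartialERing

/-! ### The partial E-ring of a prime ideal -/

namespace RatPowers

open MvPolynomial

/-- The polynomial `a + q · x` of `ℂ[x]`. -/
noncomputable def affine (n : ℕ) : ℂ × (Fin n → ℚ) →+ MvPolynomial (Fin n) ℂ where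
  toFun w := C w.1 + ∑ i, C (w.2 i : ℂ) * X i
  map_zero' := by simp
  map_add' v w := by
    simp only [Prod.fst_add, Prod.snd_add, Pi.add_apply, Rat.cast_add, map_add, add_mul,
      Finset.sum_add_distrib]
    abel

theorem affine_apply {n : ℕ} (w : ℂ × (Fin n → ℚ)) :
    affine n w = C w.1 + ∑ i, C (w.2 i : ℂ) * X i := rfl

theorem toRatPowers_affineForm {n : ℕ} (w : ℂ × (Fin n → ℚ)) :
    toRatPowers n (affineForm w.1 w.2) = AddMonoidAlgebra.single 0 (affine n w) := by
  have h : affineForm w.1 w.2 = rename Sum.inl (affine n w) := by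
    simp [affineForm, affine_apply]
  rw [← ofRoots_comp_toRoots one_pos, ← ofRoots_rename_inl (m := 1), h, RingHom.comp_apply]
  congr 1
  simp [toRoots, affine_apply]

/-- Evaluate at the origin to get a = 0, then at the unit vectors to get each q_i = 0. -/
theorem eq_zero_of_affineForm_eq_zero {n : ℕ} {w : ℂ × (Fin n → ℚ)}
    (h : affineForm w.1 w.2 = 0) : w = 0 := by
  have key (x : Fin n ⊕ Fin n → ℂ) : w.1 + ∑ i, (w.2 i : ℂ) * x (Sum.inl i) = 0 := by
    simpa [affineForm] using congrArg (eval x) h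
  have h₁ : w.1 = 0 := by simpa using key 0
  refine Prod.ext h₁ (funext fun i => ?_)
  simpa [h₁, Pi.single_apply] using key (Pi.single (Sum.inl i) 1)

section Partial

variable {n : ℕ} (I : Ideal (MvPolynomial (Fin n ⊕ Fin n) ℂ))

/-- The map `ℂ[x] → ℂ[x, y^ℚ] / I`. -/
noncomputable def polyMk : MvPolynomial (Fin n) ℂ →+* Ring n ⧸ I.map (toRatPowers n) :=
  (Ideal.Quotient.mk _).comp AddMonoidAlgebra.singleZeroRingHom

theorem polyMk_apply (p : MvPolynomial (Fin n) ℂ) :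
    polyMk I p = Ideal.Quotient.mk _ (AddMonoidAlgebra.single 0 p) := rfl

/-- The map that sends `(a, q)` to the class of `a + q · x`. -/
noncomputable def affineMk :
    (ℂ × (Fin n → ℚ)) →ₗ[ℚ] (Ring n ⧸ I.map (toRatPowers n)) :=
  ((polyMk I).toAddMonoidHom.comp (affine n)).toRatLinearMap

theorem affineMk_apply (w : ℂ × (Fin n → ℚ)) : affineMk I w = polyMk I (affine n w) := rfl

theorem affineMk_one : affineMk I (1, 0) = 1 := by
  rw [affineMk_apply, ← map_one (polyMk I)]
  congr 1
  simp [affine_apply]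

variable {I} in
-- Since the extended ideal contracts to `I`, condition 2 still excludes linear relations in the
-- quotient.
theorem affineMk_injective (hI : I.IsPrime) (hy : ∀ i, X (Sum.inr i) ∉ I)
    (hlin : ∀ (a : ℂ) (q : Fin n → ℚ), affineForm a q ∈ I → affineForm a q = 0) :
    Function.Injective (affineMk I) := by
  rw [injective_iff_map_eq_zero]
  intro w hw
  rw [affineMk_apply, polyMk_apply, Ideal.Quotient.eq_zero_iff_mem, ← toRatPowers_affineForm,
    ← Ideal.mem_comap, comap_map_toRatPowers hI hy] at hw
  exact eq_zero_of_affineForm_eq_zero (hlin _ _ hw)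

/-- The element `exp a * y ^ q` of `ℂ[x, y^ℚ] / I`. -/
noncomputable def expMk (w : ℂ × (Fin n → ℚ)) : Ring n ⧸ I.map (toRatPowers n) :=
  Ideal.Quotient.mk _ (AddMonoidAlgebra.single w.2 (C (ERing.E w.1)))

theorem expMk_zero : expMk I 0 = 1 := by
  rw [expMk, Prod.fst_zero, Prod.snd_zero, ERing.E_zero, C_1, ← AddMonoidAlgebra.one_def, map_one]

theorem expMk_add (v w : ℂ × (Fin n → ℚ)) : expMk I (v + w) = expMk I v * expMk I w := by
  rw [expMk, expMk, expMk, ← map_mul, AddMonoidAlgebra.single_mul_single, ← C_mul, ← ERing.E_add,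
    Prod.fst_add, Prod.snd_add]

/-- The ring `ℂ[x, y^ℚ] / I` as a partial E-ring: the exponential map is defined on the elements
`a + q · x`, by `E (a + q · x) = exp a * y ^ q`. -/
noncomputable def partialERing (hinj : Function.Injective (affineMk I)) : SplitPartialERing :=
  SplitPartialERing.ofInjective (affineMk I) hinj ⟨(1, 0), affineMk_one I⟩ (expMk I)
    (expMk_zero I) (expMk_add I)

variable {I} (hinj : Function.Injective (affineMk I))

theorem partialERing_E (w : ℂ × (Fin n → ℚ)) :
    (partialERing I hinj).E ⟨affineMk I w, ⟨w, rfl⟩⟩ = expMk I w :=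
  SplitPartialERing.ofInjective_E _ _ _ _ _ _ w

/-- The inclusion of `ℂ[x, y^ℚ] / I` in its free completion. -/
noncomputable def toCompl :
    (Ring n ⧸ I.map (toRatPowers n)) →+* (partialERing I hinj).Completion :=
  (partialERing I hinj).toCompletion

theorem E_toCompl_affineMk (w : ℂ × (Fin n → ℚ)) :
    ERing.E (toCompl hinj (affineMk I w)) =
      toCompl hinj (expMk I w) :=
  ((partialERing I hinj).E_toCompletion ⟨affineMk I w, ⟨w, rfl⟩⟩).trans
    (congrArg (toCompl hinj) (partialERing_E hinj w))

theorem isDomain_compl (hP : (I.map (toRatPowers n)).IsPrime) :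
    IsDomain (partialERing I hinj).Completion :=
  have : IsDomain (partialERing I hinj).carrier :=
    inferInstanceAs (IsDomain (Ring n ⧸ I.map (toRatPowers n)))
  SplitPartialERing.isDomain_completion _

end Partial

end RatPowers

section ToRatPowers

open MvPolynomial

variable {n : ℕ}

theorem toRatPowers_C (r : ℂ) : toRatPowers n (C r) = AddMonoidAlgebra.single 0 (C r) := by
  simp [toRatPowers]

theorem toRatPowers_X_inl (i : Fin n) :
    toRatPowers n (X (Sum.inl i)) = AddMonoidAlgebra.single 0 (X i) := by
  simp [toRatPowers]

theorem toRatPowers_X_inr (i : Fin n) :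
    toRatPowers n (X (Sum.inr i)) = AddMonoidAlgebra.single (Pi.single i 1) 1 := by
  simp [toRatPowers]

end ToRatPowers

namespace EPolynomial

open MvPolynomial

/-! ### Universal property of the ring of exponential polynomials -/

section Universal

variable {σ K : Type*} [CommRing K] [Algebra ℚ K] [ERing K] {S : Type*} [CommRing S] [ERing S]

/-- The homomorphism from the ring of exponential polynomials that extends a given homomorphism
from the polynomial ring. -/
noncomputable def liftPoly (φ : MvPolynomial σ K →+* S) : EPolynomial σ K →+* S :=
  (base σ K).lift φ

theorem base_E (σ : Type*) (r : K) :
    (base σ K).E ⟨constLinear σ K r, ⟨r, rfl⟩⟩ = (C (ERing.E r) : MvPolynomial σ K) := by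
  change C (ERing.E (constantCoeff (C r : MvPolynomial σ K))) = _
  rw [constantCoeff_C]

theorem E_ofPoly_C (r : K) : ERing.E (ofPoly σ K (C r)) = ofPoly σ K (C (ERing.E r)) :=
  ((base σ K).E_toCompletion ⟨constLinear σ K r, ⟨r, rfl⟩⟩).trans
    (congrArg (ofPoly σ K) (base_E σ r))

/-- In the base ring E is defined on the constants only, so compatibility is needed only there. -/
theorem liftPoly_E (φ : MvPolynomial σ K →+* S)
    (hφ : ∀ r, φ (C (ERing.E r)) = ERing.E (φ (C r))) (a : EPolynomial σ K) :
    liftPoly φ (ERing.E a) = ERing.E (liftPoly φ a) := by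
  refine (base σ K).lift_E φ ?_ a
  rintro ⟨_, r, rfl⟩
  exact (congrArg φ (base_E σ r)).trans (hφ r)

theorem hom_ext {f g : EPolynomial σ K →+* S} (hf : ∀ x, f (ERing.E x) = ERing.E (f x))
    (hg : ∀ x, g (ERing.E x) = ERing.E (g x)) (hC : ∀ r, f (ofPoly σ K (C r)) = g (ofPoly σ K (C r)))
    (hX : ∀ i, f (X K i) = g (X K i)) : f = g :=
  (base σ K).completion_hom_ext hf hg
    (MvPolynomial.ringHom_ext (f := f.comp (ofPoly σ K)) (g := g.comp (ofPoly σ K)) hC hX)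

theorem substExp_C (r : K) : substExp σ K (C r) = ofPoly σ K (C r) := by
  simp [substExp]

theorem substExp_X_inl (i : σ) : substExp σ K (MvPolynomial.X (Sum.inl i)) = X K i := by
  simp [substExp]

theorem substExp_X_inr (i : σ) :
    substExp σ K (MvPolynomial.X (Sum.inr i)) = ERing.E (X K i) := by
  simp [substExp]

end Universal

/-! ### The generated E-ideal as a kernel -/

section Prime

variable {n : ℕ} {I : Ideal (MvPolynomial (Fin n ⊕ Fin n) ℂ)}
  (hinj : Function.Injective (RatPowers.affineMk I))

open RatPowers

theorem affineMk_const (r : ℂ) : affineMk I (r, 0) = polyMk I (C r) := by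
  simp [affineMk_apply, affine_apply]

theorem affine_single (i : Fin n) : affine n (0, Pi.single i 1) = MvPolynomial.X i := by
  rw [affine_apply]
  simp [Pi.single_apply, apply_ite (Rat.cast (K := ℂ)), apply_ite C, ite_mul]

theorem affineMk_single (i : Fin n) :
    affineMk I (0, Pi.single i 1) = polyMk I (MvPolynomial.X i) := by
  rw [affineMk_apply, affine_single]

/-- The homomorphism of E-rings from `ℂ[x]^E` to the free completion of `ℂ[x, y^ℚ] / I`. -/
noncomputable def toGeneric : EPolynomial (Fin n) ℂ →+* (partialERing I hinj).Completion :=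
  liftPoly ((toCompl hinj).comp (polyMk I))

theorem toGeneric_ofPoly (p : MvPolynomial (Fin n) ℂ) :
    toGeneric hinj (ofPoly _ _ p) = toCompl hinj (polyMk I p) := rfl

/-- A constant r is a + q·x with q = 0, so its exponential in the completion is already exp(r). -/
theorem toGeneric_E (a : EPolynomial (Fin n) ℂ) :
    toGeneric hinj (ERing.E a) = ERing.E (toGeneric hinj a) := by
  refine liftPoly_E _ (fun r => ?_) a
  rw [RingHom.comp_apply, RingHom.comp_apply, ← affineMk_const r, E_toCompl_affineMk, polyMk_apply, expMk]

/-- The point is E(x_i) ↦ y_i: x_i is a + q·x with a = 0 and q the i-th unit vector. -/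
theorem toGeneric_substExp (p : MvPolynomial (Fin n ⊕ Fin n) ℂ) :
    toGeneric hinj (substExp _ _ p) =
      toCompl hinj (Ideal.Quotient.mk _ (toRatPowers n p)) := by
  have : (toGeneric hinj).comp (substExp _ _) =
      (toCompl hinj).comp ((Ideal.Quotient.mk _).comp (toRatPowers n)) := by
    refine MvPolynomial.ringHom_ext (fun r => ?_) (fun i => ?_)
    · simp only [RingHom.comp_apply, substExp_C, toGeneric_ofPoly, toRatPowers_C, polyMk_apply]
    · rcases i with i | i
      · simp only [RingHom.comp_apply, substExp_X_inl, X, toGeneric_ofPoly, toRatPowers_X_inl,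
          polyMk_apply]
      · simp only [RingHom.comp_apply, substExp_X_inr, toGeneric_E, X, toGeneric_ofPoly,
          toRatPowers_X_inr]
        rw [← affineMk_single, E_toCompl_affineMk, expMk, ERing.E_zero, C_1]
  exact congrArg (· p) this

theorem substExp_mem_ker_toGeneric {p : MvPolynomial (Fin n ⊕ Fin n) ℂ} (hp : p ∈ I) :
    substExp _ _ p ∈ RingHom.ker (toGeneric hinj) := by
  rw [RingHom.mem_ker, toGeneric_substExp,
    Ideal.Quotient.eq_zero_iff_mem.2 (Ideal.mem_map_of_mem _ hp), map_zero]

/-- The substitution `y^q ↦ E (q · x)`. -/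
noncomputable def substRat (n : ℕ) : RatPowers.Ring n →+* EPolynomial (Fin n) ℂ :=
  AddMonoidAlgebra.liftNCRingHom (ofPoly (Fin n) ℂ)
    { toFun := fun q => ERing.E (ofPoly (Fin n) ℂ (affine n (0, q.toAdd)))
      map_one' := by
        rw [toAdd_one, show ((0 : ℂ), (0 : Fin n → ℚ)) = 0 from rfl, map_zero, map_zero,
          ERing.E_zero]
      map_mul' := fun p q => by
        rw [← ERing.E_add, ← map_add, ← map_add, toAdd_mul, Prod.mk_add_mk, add_zero] }
    (fun _ _ => Commute.all _ _)

theorem substRat_single (q : Fin n → ℚ) (p : MvPolynomial (Fin n) ℂ) :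
    substRat n (AddMonoidAlgebra.single q p) =
      ofPoly _ _ p * ERing.E (ofPoly (Fin n) ℂ (affine n (0, q))) :=
  AddMonoidAlgebra.liftNCRingHom_single _ _ _ _ _

theorem substRat_single_zero (p : MvPolynomial (Fin n) ℂ) :
    substRat n (AddMonoidAlgebra.single 0 p) = ofPoly _ _ p := by
  rw [substRat_single, show ((0 : ℂ), (0 : Fin n → ℚ)) = 0 from rfl, map_zero, map_zero,
    ERing.E_zero, mul_one]

theorem substRat_toRatPowers (p : MvPolynomial (Fin n ⊕ Fin n) ℂ) :
    substRat n (toRatPowers n p) = substExp _ _ p := by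
  have : (substRat n).comp (toRatPowers n) = substExp (Fin n) ℂ := by
    refine MvPolynomial.ringHom_ext (fun r => ?_) (fun i => ?_)
    · rw [RingHom.comp_apply, toRatPowers_C, substRat_single_zero, substExp_C]
    · rcases i with i | i
      · rw [RingHom.comp_apply, toRatPowers_X_inl, substRat_single_zero, substExp_X_inl, X]
      · rw [RingHom.comp_apply, toRatPowers_X_inr, substRat_single, affine_single, map_one, one_mul,
          substExp_X_inr, X]
  exact congrArg (· p) this

/-- The quotient map to ℂ[x]^E/L factors through `toGeneric`, by the universal property of the
completion applied to the E-ring ℂ[x]^E/L. -/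
theorem ker_toGeneric_le {L : Ideal (EPolynomial (Fin n) ℂ)} (hL : IsEIdeal L)
    (hIL : ∀ p ∈ I, substExp (Fin n) ℂ p ∈ L) : RingHom.ker (toGeneric hinj) ≤ L := by
  let := hL.quotientERing
  let ψ : RatPowers.Ring n ⧸ I.map (toRatPowers n) →+* EPolynomial (Fin n) ℂ ⧸ L :=
    Ideal.quotientMap L (substRat n) (Ideal.map_le_iff_le_comap.2 fun p hp => by
      rw [Ideal.mem_comap, Ideal.mem_comap, substRat_toRatPowers]
      exact hIL p hp)
  have hψ (f : RatPowers.Ring n) :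
      ψ (Ideal.Quotient.mk _ f) = Ideal.Quotient.mk L (substRat n f) := rfl
  have hψpoly (p : MvPolynomial (Fin n) ℂ) :
      ψ (polyMk I p) = Ideal.Quotient.mk L (ofPoly _ _ p) := by
    rw [polyMk_apply, hψ, substRat_single_zero]
  -- On a + q·x both sides are the class of E(a)·E(q·x) = E(a + q·x).
  have hψE : ∀ v : (partialERing I hinj).V,
      ψ ((partialERing I hinj).E v) = ERing.E (ψ (v : (partialERing I hinj).carrier)) := by
    rintro ⟨_, w, rfl⟩
    refine (congrArg ψ (partialERing_E hinj w)).trans ?_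
    change _ = ERing.E (ψ (affineMk I w))
    rw [affineMk_apply, expMk, hψ, hψpoly, substRat_single, ← E_ofPoly_C, ← ERing.E_add, ← map_add,
      hL.mk_E]
    congr 3
    simp [affine_apply]
  let Ψ : (partialERing I hinj).Completion →+* EPolynomial (Fin n) ℂ ⧸ L :=
    (partialERing I hinj).lift ψ
  have hΨ (p : MvPolynomial (Fin n) ℂ) :
      Ψ (toGeneric hinj (ofPoly _ _ p)) = Ideal.Quotient.mk L (ofPoly _ _ p) := hψpoly p
  -- Both sides are homomorphisms of E-rings that agree on constants and variables.
  have key : Ψ.comp (toGeneric hinj) = Ideal.Quotient.mk L := by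
    refine hom_ext (fun a => ?_) hL.mk_E (fun r => hΨ (C r)) (fun i => hΨ (MvPolynomial.X i))
    rw [RingHom.comp_apply, toGeneric_E]
    exact (partialERing I hinj).lift_E ψ hψE _
  intro a ha
  rw [← Ideal.Quotient.eq_zero_iff_mem, ← key, RingHom.comp_apply, (RingHom.mem_ker).1 ha, map_zero]

theorem eIdealSpan_eq_ker_toGeneric :
    eIdealSpan (substExp (Fin n) ℂ '' (I : Set _)) = RingHom.ker (toGeneric hinj) := by
  refine le_antisymm (sInf_le ⟨isEIdeal_ker (toGeneric_E hinj), ?_⟩) (le_sInf ?_)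
  · rintro _ ⟨p, hp, rfl⟩
    exact substExp_mem_ker_toGeneric hinj hp
  · rintro L ⟨hL, hIL⟩
    exact ker_toGeneric_le hinj hL fun p hp => hIL ⟨p, hp, rfl⟩

end Prime

end EPolynomial

theorem mainTheorem5 (n : ℕ) (I : Ideal (MvPolynomial (Fin n ⊕ Fin n) ℂ))
    (h1 : I.IsPrime)
    (h2 : ∀ (a : ℂ) (q : Fin n → ℚ), affineForm a q ∈ I → affineForm a q = 0)
    (h3 : ∀ (q : Fin n → ℚ) (a : ℂ), ∀ p ∈ I, toRatPowers n p = ratMonomialSub q a → p = 0)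
    (h4 : ∀ m : ℕ, 0 < m → (rootExtension m I).IsPrime) :
    IsPrimeEIdeal (eIdealSpan (EPolynomial.substExp (Fin n) ℂ '' (I : Set _))) := by
  -- Condition 3 with q the i-th unit vector and a = 0: the element y^q − a is y_i itself.
  have hy (i) : MvPolynomial.X (Sum.inr i) ∉ I := fun hi =>
    MvPolynomial.X_ne_zero _ (h3 (Pi.single i 1) 0 _ hi (by simp [toRatPowers_X_inr, ratMonomialSub]))
  have hinj := RatPowers.affineMk_injective h1 hy h2
  have := RatPowers.isDomain_compl hinj (RatPowers.isPrime_map_toRatPowers h1 hy h4)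
  rw [EPolynomial.eIdealSpan_eq_ker_toGeneric hinj]
  exact ⟨isEIdeal_ker (EPolynomial.toGeneric_E hinj), RingHom.ker_isPrime _⟩
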